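/- Let $\mathcal D X$ be the set of finitely supported probability distributions on a set $X$, with flattening $\mu_X:\mathcal D\mathcal D X\to\mathcal D X$, $\mu_X(\Phi)(x)=\sum_{\varphi}\Phi(\varphi)\varphi(x)$, and let $\mathcal P$ be the (full) covariant powerset functor. Let $A$ be a set of labels and let $c:X\to(\mathcal P\mathcal D X)^A$ be a probabilistic automaton. Consider the weak distributive law $\delta_Y:\mathcal D\mathcal P Y\to\mathcal P\mathcal D Y$, $$\delta_Y\Big(\sum_i p_iS_i\Big)=\Big\{\sum_i p_i\varphi_i \;\Big|\; \forall i,\ \operatorname{supp}(\varphi_i)\subseteq S_i\Big\}\qquad(S_i\text{ distinct},\ p_i>0),$$ and the law $\sigma_Y:\mathcal D(Y^A)\to(\mathcal D Y)^A$, $\sigma_Y(\Phi)(a)(y)=\sum_{f\in Y^A,\,f(a)=y}\Phi(f)$. The determinization (belief-state transformer) of $c$ is $$c^+=(\mathcal P\mu_X)^A\circ(\delta_{\mathcal D X})^A\circ\sigma_{\mathcal P\mathcal D X}\circ\mathcal D c:\ \mathcal D X\to(\mathcal P\mathcal D X)^A .$$ Write $F=(\mathcal P-)^A$ and, for $R\subseteq\mathcal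 D X\times\mathcal D X$ with projections $\pi_1,\pi_2:R\to\mathcal D X$, let $$b(R)=\{(u,v)\mid \exists t\in F R,\ c^+(u)=F\pi_1(t)\text{ and }c^+(v)=F\pi_2(t)\}.$$ An up-to technique is a monotone map $f$ on relations on $\mathcal D X$; it is $b$-compatible if $f(b(R))\subseteq b(f(R))$ for every $R$. Let $$\mathrm{Ctx}(R)=\{(\mu_X(\mathcal D\pi_1(t)),\mu_X(\mathcal D\pi_2(t)))\mid t\in\mathcal D R\},\qquad \mathrm{Cgr}(R)=\bigcup_{n\ge0}(\mathrm{Tra}\cup\mathrm{Sym}\cup\mathrm{Ctx}\cup\mathrm{Rfl})^n(R),$$ where $\mathrm{Tra}(R)=R\circ R$, $\mathrm{Sym}(R)=R^{-1}$, $\mathrm{Rfl}(R)$ is the identity relation, unions of maps are pointwise and powers are iterates. Then: (1) $\mathrm{Ctx}$ is the convex hull: $\mathrm{Ctx}(R)=\{(\sum_{i\in I}p_i\varphi_i,\sum_{i\in I}p_i\psi_i)\mid I\text{ finite},\ p_i\in(0,1],\ \sum_{i\in I} p_i=1,\ (\varphi_i,\psi_i)\in R\}$ for every $R$; (2) convex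 hull is a $b$-compatible up-to technique; (3) the congruence closure $\mathrm{Cgr}$ is a $b$-compatible up-to technique. -/

import Mathlib

open Convexity

universe u v

namespace ProbAut

/-! ### The functors

`StdSimplex ℝ X` is the set `𝒟 X` of finitely supported probability distributions on `X`;
`StdSimplex.map` is the pushforward and `StdSimplex.join` the flattening of distributions. -/

/-- The finite distribution functor `𝒟`. -/
noncomputable instance : Functor (fun X : Type u => StdSimplex ℝ X) where
  map f φ := φ.map f

instance : LawfulFunctor (fun X : Type u => StdSimplex ℝ X) where
  map_const := rfl
  id_map φ := StdSimplex.map_id φ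
  comp_map f g φ := StdSimplex.map_comp φ f g

/-- The functor `(𝒫 -)^A`, where `𝒫` is the (full) powerset functor. -/
def PowExp (A : Type v) (Y : Type u) : Type (max u v) := A → Set Y

/-- On functions, `(𝒫 -)^A` takes direct images label by label. -/
instance (A : Type v) : Functor (PowExp.{u, v} A) where
  map f t := fun a => f '' t a

instance (A : Type v) : LawfulFunctor (PowExp.{u, v} A) where
  map_const := rfl
  id_map t := funext fun a => Set.image_id (t a)
  comp_map f g t := funext fun a => Set.image_comp g f (t a)

/-! ### Relation lifting and up-to techniques, for a coalgebra `ξ : Z → F Z` -/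

/-- First projection `R → Z` of a relation on `Z`. -/
def proj₁ {Z : Type u} (R : SetRel Z Z) (r : ↥R) : Z := r.1.1

/-- Second projection `R → Z` of a relation on `Z`. -/
def proj₂ {Z : Type u} (R : SetRel Z Z) (r : ↥R) : Z := r.1.2

/-- `Rel(F)_ξ(R)`: the pairs `(u, v)` such that `(ξ u, ξ v) = (F π₁ t, F π₂ t)` for some
`t ∈ F R`. -/
def relLift (F : Type u → Type v) [Functor F] {Z : Type u} (ξ : Z → F Z)
    (R : SetRel Z Z) : SetRel Z Z :=
  {p | ∃ t : F ↥R, ξ p.1 = proj₁ R <$> t ∧ ξ p.2 = proj₂ R <$> t}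

/-- An up-to technique is a monotone function on relations. -/
def IsUpToTechnique {Z : Type u} (tch : SetRel Z Z → SetRel Z Z) : Prop :=
  ∀ ⦃R S : SetRel Z Z⦄, R ⊆ S → tch R ⊆ tch S

/-- `tch` is `b`-compatible if `tch ∘ b ⊆ b ∘ tch`. -/
def IsCompatible {Z : Type u} (b tch : SetRel Z Z → SetRel Z Z) : Prop :=
  ∀ R : SetRel Z Z, tch (b R) ⊆ b (tch R)

/-- Contextual closure `Ctx_α` with respect to an algebra `α : T Z → Z`. -/
def ctx (T : Type u → Type v) [Functor T] {Z : Type u} (α : T Z → Z)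
    (R : SetRel Z Z) : SetRel Z Z :=
  {p | ∃ t : T ↥R, p = (α (proj₁ R <$> t), α (proj₂ R <$> t))}

/-- `Tra ∪ Sym ∪ Ctx_α ∪ Rfl`. -/
def cgrStep (T : Type u → Type v) [Functor T] {Z : Type u} (α : T Z → Z)
    (R : SetRel Z Z) : SetRel Z Z :=
  R.comp R ∪ R.inv ∪ ctx T α R ∪ SetRel.id

/-- Congruence closure `Cgr_α = ⋃ₙ (Tra ∪ Sym ∪ Ctx_α ∪ Rfl)ⁿ`. -/
def cgr (T : Type u → Type v) [Functor T] {Z : Type u} (α : T Z → Z)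
    (R : SetRel Z Z) : SetRel Z Z :=
  ⋃ n : ℕ, (cgrStep T α)^[n] R

/-! ### Probabilistic automata and their determinization -/

/-- The weak distributive law `𝒟𝒫 ⇒ 𝒫𝒟`, sending `∑ᵢ pᵢ Sᵢ` (distinct `Sᵢ`, positive `pᵢ`) to
`{∑ᵢ pᵢ φᵢ | ∀ i, supp φᵢ ⊆ Sᵢ}`. The family `(φᵢ)` is given by a function of the set `Sᵢ`. -/
def distPow {Y : Type u} (Φ : StdSimplex ℝ (Set Y)) : Set (StdSimplex ℝ Y) :=
  {ψ | ∃ φ : Set Y → StdSimplex ℝ Y,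
    (∀ S ∈ Φ.weights.support, (↑(φ S).weights.support : Set Y) ⊆ S) ∧ ψ = (Φ.map φ).join}

/-- The distributive law `𝒟(-^A) ⇒ (𝒟 -)^A`,
`Φ ↦ (a ↦ (y ↦ ∑_{f, f a = y} Φ f))`, i.e. the marginal of `Φ` at `a`. -/
noncomputable def distExp {A : Type v} {Y : Type u} (Φ : StdSimplex ℝ (A → Y)) :
    A → StdSimplex ℝ Y :=
  fun a => Φ.map (fun f => f a)

/-- The determinization (belief-state transformer) of a probabilistic automaton
`c : X → (𝒫𝒟X)^A`, namely the composite
`𝒟X → 𝒟((𝒫𝒟X)^A) → (𝒟𝒫𝒟X)^A → (𝒫𝒟𝒟X)^A → (𝒫𝒟X)^A`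
of `𝒟 c`, the law `distExp`, the weak law `distPow`, and flattening. -/
noncomputable def determinize {A : Type v} {X : Type u} (c : X → A → Set (StdSimplex ℝ X)) :
    StdSimplex ℝ X → A → Set (StdSimplex ℝ X) :=
  fun φ a => StdSimplex.join '' distPow (distExp (φ.map c) a)

/-- Convex hull of a relation on distributions: all pairs `(∑ᵢ pᵢ φᵢ, ∑ᵢ pᵢ ψᵢ)` with finite index
set, `pᵢ ∈ (0, 1]`, `∑ᵢ pᵢ = 1` and `(φᵢ, ψᵢ) ∈ R`. -/
def convexHullRel {X : Type u} (R : SetRel (StdSimplex ℝ X) (StdSimplex ℝ X)) :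
    SetRel (StdSimplex ℝ X) (StdSimplex ℝ X) :=
  {q | ∃ (n : ℕ) (p : Fin n → ℝ) (φ ψ : Fin n → StdSimplex ℝ X),
    (∀ i, 0 < p i ∧ p i ≤ 1) ∧ ∑ i, p i = 1 ∧ (∀ i, (φ i, ψ i) ∈ R) ∧
    q.1.weights = ∑ i, p i • (φ i).weights ∧ q.2.weights = ∑ i, p i • (ψ i).weights}

end ProbAut

/-! The heart of the matter is that `determinize c` is affine: label by label, the successors of `∑
pᵢ uᵢ` are exactly the mixtures `∑ pᵢ θᵢ` with `θᵢ` a successor of `uᵢ`. Both inclusions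
(`iConvexComb_mem_determinize`, `exists_of_mem_determinize_iConvexComb`) rest on
`mem_determinize_iff`, which replaces the choice of one distribution per set, made by the weak law,
by a choice per state. Since `b` is Egli–Milner lifting, a move of a mixture splits into moves of
its components; these are matched one by one and recombined, so convex hull is compatible.
Transitivity, symmetry and reflexivity are compatible for every coalgebra of this type, and
compatibility passes to unions and iterates of monotone maps. -/

namespace ProbAut

open StdSimplex

/-! ### Mixtures and disintegration of finitely supported distributions -/

section Simplex

variable {I J M : Type*}

theorem weights_iConvexComb_eq_sum (w : StdSimplex ℝ I) (g : I → StdSimplex ℝ J) :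
    (w.iConvexComb g).weights = w.weights.sum fun i r => r • (g i).weights := by
  simp [iConvexComb, Finsupp.sum_mapDomain_index, add_smul]

theorem exists_of_mem_support_iConvexComb {w : StdSimplex ℝ I} {g : I → StdSimplex ℝ J} {j : J}
    (hj : j ∈ (w.iConvexComb g).weights.support) :
    ∃ i ∈ w.weights.support, j ∈ (g i).weights.support := by
  classical
  rw [weights_iConvexComb_eq_sum] at hj
  obtain ⟨i, hi, hij⟩ := Finset.mem_biUnion.1 (Finsupp.support_sum hj)
  exact ⟨i, hi, Finsupp.support_smul hij⟩

/-- Existence of conditional distributions of a finitely supported distribution given the value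
of a function. -/
theorem exists_conditional (w : StdSimplex ℝ I) (f : I → J) :
    ∃ κ : J → StdSimplex ℝ I, (w.map f).iConvexComb κ = w ∧
      ∀ j ∈ (w.map f).weights.support, ∀ i ∈ (κ j).weights.support,
        f i = j ∧ i ∈ w.weights.support := by
  classical
  let κ : J → StdSimplex ℝ I := fun j =>
    if h : ∃ i ∈ f ⁻¹' {j}, w.weights i ≠ 0 then w.restrict _ h else w
  have hmass (j : J) : (w.map f).weights j =
      (w.weights.filter (· ∈ f ⁻¹' {j})).sum fun _ k => k := by
    rw [weights_map, Finsupp.mapDomain, Finsupp.sum_apply, Finsupp.sum_filter_index,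
      Finsupp.support_filter, Finset.sum_filter]
    exact Finset.sum_congr rfl fun i _ => by simp [Finsupp.single_apply]
  have hex {j : J} (hj : j ∈ (w.map f).weights.support) :
      ∃ i ∈ f ⁻¹' {j}, w.weights i ≠ 0 := by
    obtain ⟨i, hi, hij⟩ := Finset.mem_image.1 (Finsupp.mapDomain_support hj)
    exact ⟨i, hij, Finsupp.mem_support_iff.1 hi⟩
  have hκ {j : J} (hj : j ∈ (w.map f).weights.support) :
      κ j = w.restrict _ (hex hj) := dif_pos (hex hj)
  refine ⟨κ, ?_, fun j hj i hi => ?_⟩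
  · ext i
    have hterm : (w.map f).weights.sum (fun j r => r • (κ j).weights) =
        ∑ j ∈ (w.map f).weights.support, w.weights.filter (· ∈ f ⁻¹' {j}) := by
      refine Finset.sum_congr rfl fun j hj => ?_
      beta_reduce
      rw [hκ hj, weights_restrict, ← hmass, smul_inv_smul₀ (Finsupp.mem_support_iff.1 hj)]
    rw [weights_iConvexComb_eq_sum, hterm, Finsupp.finsetSum_apply]
    simp only [Finsupp.filter_apply, Set.mem_preimage, Set.mem_singleton_iff, Finset.sum_ite_eq]
    -- If the fibre of `i` has mass zero, nonnegativity forces `w` to vanish at `i`.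
    refine ite_eq_left_iff.2 fun h => ?_
    by_contra hne
    rw [Finsupp.notMem_support_iff, hmass, Finsupp.sum,
      Finset.sum_eq_zero_iff_of_nonneg fun k _ => by
        rw [Finsupp.filter_apply]; split_ifs <;> simp] at h
    have := h i (by simpa using Ne.symm hne)
    rw [Finsupp.filter_apply_pos _ _ (by simp)] at this
    exact hne this.symm
  · rw [hκ hj, support_weights_restrict, Finset.mem_filter] at hi
    exact ⟨hi.2, hi.1⟩

end Simplex

/-! ### The determinization is affine -/

section Determinize

variable {I : Type*} {X : Type u} {A : Type v} (c : X → A → Set (StdSimplex ℝ X))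

/-- States with the same successor set may choose different `ψ x`. Averaging these choices stays
supported in that set, so it yields one choice per set with the same total mixture. -/
theorem mem_determinize_iff {u : StdSimplex ℝ X} {a : A} {θ : StdSimplex ℝ X} :
    θ ∈ determinize c u a ↔ ∃ ψ : X → StdSimplex ℝ (StdSimplex ℝ X),
      (∀ x ∈ u.weights.support, (↑(ψ x).weights.support : Set (StdSimplex ℝ X)) ⊆ c x a) ∧
      θ = u.iConvexComb fun x => (ψ x).sConvexComb := by
  classical
  have hΦ : distExp (u.map c) a = u.map fun x => c x a := map_map ..
  constructor
  · rintro ⟨Ψ, ⟨φ, hφ, rfl⟩, rfl⟩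
    rw [hΦ] at hφ ⊢
    refine ⟨fun x => φ (c x a), fun x hx => hφ _ ?_, ?_⟩
    · rw [Finsupp.mem_support_iff, weights_map]
      have hle : u.weights x ≤ (u.weights.mapDomain fun x => c x a) (c x a) := by
        rw [Finsupp.mapDomain, Finsupp.sum_apply]
        refine le_trans (by simp) (Finset.single_le_sum (f := fun y =>
          Finsupp.single (c y a) (u.weights y) (c x a)) (fun y _ => ?_) hx)
        rw [Finsupp.single_apply]; split_ifs <;> simp
      exact ((lt_of_le_of_ne (u.weights_nonneg x)
        (Ne.symm (Finsupp.mem_support_iff.1 hx))).trans_le hle).ne'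
    · change (iConvexComb (u.map fun x => c x a) φ).sConvexComb = _
      rw [← iConvexComb_id, ← iConvexComb_assoc, iConvexComb_map]
      simp only [iConvexComb_id]
  · rintro ⟨ψ, hψ, rfl⟩
    -- `κ S` is the law of the state given that its successor set is `S`.
    obtain ⟨κ, hκ, hs⟩ := exists_conditional u fun x => c x a
    refine ⟨u.iConvexComb ψ, ⟨fun S => (κ S).iConvexComb ψ, ?_, ?_⟩, ?_⟩
    · rw [hΦ]
      intro S hS y hy
      obtain ⟨x, hx, hxy⟩ := exists_of_mem_support_iConvexComb hy
      obtain ⟨rfl, hxu⟩ := hs S hS x hx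
      exact hψ x hxu hxy
    · rw [hΦ]
      change _ = iConvexComb (u.map fun x => c x a) _
      rw [iConvexComb_assoc, hκ]
    · change (u.iConvexComb ψ).sConvexComb = _
      rw [← iConvexComb_id, ← iConvexComb_assoc]
      simp only [iConvexComb_id]

/-- A state may occur in several `u i` with different choices `ψ i x`; these are averaged over the
law of `i` given `x`. -/
theorem iConvexComb_mem_determinize {w : StdSimplex ℝ I} {u θ : I → StdSimplex ℝ X} {a : A}
    (h : ∀ i ∈ w.weights.support, θ i ∈ determinize c (u i) a) :
    w.iConvexComb θ ∈ determinize c (w.iConvexComb u) a := by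
  classical
  have hex (i : I) : ∃ ψ : X → StdSimplex ℝ (StdSimplex ℝ X), i ∈ w.weights.support →
      (∀ x ∈ (u i).weights.support, (↑(ψ x).weights.support : Set (StdSimplex ℝ X)) ⊆ c x a) ∧
      θ i = (u i).iConvexComb fun x => (ψ x).sConvexComb := by
    by_cases hi : i ∈ w.weights.support
    · obtain ⟨ψ, hψ⟩ := (mem_determinize_iff c).1 (h i hi)
      exact ⟨ψ, fun _ => hψ⟩
    · exact ⟨fun _ => single (θ i), fun h => (hi h).elim⟩
  choose ψ hψ using hex
  -- Joint law of index and state; its second marginal is the mixture of the `u i`.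
  let W : StdSimplex ℝ (I × X) := w.iConvexComb fun i => (u i).map (Prod.mk i)
  have hW : W.map Prod.snd = w.iConvexComb u := by
    rw [map_iConvexComb]
    congr 1
    funext i
    exact (map_map ..).trans (map_id _)
  obtain ⟨κ, hκ, hs⟩ := exists_conditional W Prod.snd
  rw [hW] at hκ hs
  refine (mem_determinize_iff c).2 ⟨fun x => (κ x).iConvexComb fun k => ψ k.1 k.2, ?_, ?_⟩
  · intro x hx y hy
    obtain ⟨⟨i, x'⟩, hk, hky⟩ := exists_of_mem_support_iConvexComb hy
    obtain ⟨rfl, hkW⟩ := hs x hx _ hk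
    obtain ⟨i', hi', hmem⟩ := exists_of_mem_support_iConvexComb hkW
    obtain ⟨x'', hx'', heq⟩ := Finset.mem_image.1 (Finsupp.mapDomain_support hmem)
    obtain ⟨rfl, rfl⟩ := Prod.mk.inj heq
    exact (hψ _ hi').1 _ hx'' hky
  · calc w.iConvexComb θ
        = w.iConvexComb fun i => (u i).iConvexComb fun x => (ψ i x).sConvexComb :=
          iConvexComb_congr fun i hi => (hψ i (Finsupp.mem_support_iff.2 hi)).2
      _ = W.iConvexComb fun k => (ψ k.1 k.2).sConvexComb := iConvexComb_assoc' ..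
      _ = (w.iConvexComb u).iConvexComb fun x =>
            (κ x).iConvexComb fun k => (ψ k.1 k.2).sConvexComb := by
          rw [iConvexComb_assoc, hκ]
      _ = _ := by
          congr 1
          funext x
          rw [← iConvexComb_id ((κ x).iConvexComb _), ← iConvexComb_assoc]
          simp only [iConvexComb_id]

/-- One choice `ψ` serves all components, because each `u i` of positive weight has its support
inside that of the mixture. -/
theorem exists_of_mem_determinize_iConvexComb {w : StdSimplex ℝ I} {u : I → StdSimplex ℝ X}
    {a : A} {θ : StdSimplex ℝ X} (h : θ ∈ determinize c (w.iConvexComb u) a) :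
    ∃ θ' : I → StdSimplex ℝ X, (∀ i ∈ w.weights.support, θ' i ∈ determinize c (u i) a) ∧
      θ = w.iConvexComb θ' := by
  classical
  obtain ⟨ψ, hψ, rfl⟩ := (mem_determinize_iff c).1 h
  refine ⟨fun i => (u i).iConvexComb fun x => (ψ x).sConvexComb, fun i hi =>
    (mem_determinize_iff c).2 ⟨ψ, fun x hx => hψ x ?_, rfl⟩, (iConvexComb_assoc ..).symm⟩
  rw [weights_iConvexComb_eq_sum, Finsupp.mem_support_iff, Finsupp.sum_apply]
  refine (Finset.sum_pos' (fun j _ => ?_) ⟨i, hi, ?_⟩).ne'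
  · exact mul_nonneg (w.weights_nonneg j) ((u j).weights_nonneg x)
  · exact mul_pos
      (lt_of_le_of_ne (w.weights_nonneg i) (Ne.symm (Finsupp.mem_support_iff.1 hi)))
      (lt_of_le_of_ne ((u i).weights_nonneg x) (Ne.symm (Finsupp.mem_support_iff.1 hx)))

end Determinize

/-! ### Egli–Milner lifting and its compatible operations -/

section RelLift

variable {Z : Type u} {A : Type v} (ξ : Z → A → Set Z)

/-- The lifting of a relation along `(𝒫 -)^A` is the Egli–Milner lifting, label by label. -/
theorem mem_relLift_iff {R : SetRel Z Z} {u v : Z} :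
    (u, v) ∈ relLift (PowExp A) ξ R ↔ ∀ a,
      (∀ x ∈ ξ u a, ∃ y ∈ ξ v a, (x, y) ∈ R) ∧ ∀ y ∈ ξ v a, ∃ x ∈ ξ u a, (x, y) ∈ R := by
  constructor
  · rintro ⟨t, h₁, h₂⟩ a
    replace h₁ : ξ u a = proj₁ R '' t a := congrFun h₁ a
    replace h₂ : ξ v a = proj₂ R '' t a := congrFun h₂ a
    rw [h₁, h₂]
    constructor
    · rintro _ ⟨r, hr, rfl⟩
      exact ⟨_, ⟨r, hr, rfl⟩, r.2⟩
    · rintro _ ⟨r, hr, rfl⟩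
      exact ⟨_, ⟨r, hr, rfl⟩, r.2⟩
  · intro h
    -- The largest possible witness: all pairs of `R` between the two successor sets.
    refine ⟨fun a => {r | r.1.1 ∈ ξ u a ∧ r.1.2 ∈ ξ v a}, ?_, ?_⟩
    · funext a
      refine Set.Subset.antisymm (fun x hx => ?_) ?_
      · obtain ⟨y, hy, hxy⟩ := (h a).1 x hx
        exact ⟨⟨(x, y), hxy⟩, ⟨hx, hy⟩, rfl⟩
      · rintro _ ⟨r, hr, rfl⟩
        exact hr.1
    · funext a
      refine Set.Subset.antisymm (fun y hy => ?_) ?_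
      · obtain ⟨x, hx, hxy⟩ := (h a).2 y hy
        exact ⟨⟨(x, y), hxy⟩, ⟨hx, hy⟩, rfl⟩
      · rintro _ ⟨r, hr, rfl⟩
        exact hr.2

theorem relLift_mono : IsUpToTechnique (relLift (PowExp A) ξ) := by
  rintro R S hRS ⟨u, v⟩ h
  rw [mem_relLift_iff] at h ⊢
  exact fun a => ⟨fun x hx => ((h a).1 x hx).imp fun _ => And.imp_right (@hRS _),
    fun y hy => ((h a).2 y hy).imp fun _ => And.imp_right (@hRS _)⟩

theorem isCompatible_comp : IsCompatible (relLift (PowExp A) ξ) fun R => R.comp R := by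
  rintro R ⟨u, v⟩ ⟨w, huw, hwv⟩
  replace huw := (mem_relLift_iff ξ).1 huw
  replace hwv := (mem_relLift_iff ξ).1 hwv
  refine (mem_relLift_iff ξ).2 fun a => ⟨fun x hx => ?_, fun y hy => ?_⟩
  · obtain ⟨z, hz, hxz⟩ := (huw a).1 x hx
    obtain ⟨y, hy, hzy⟩ := (hwv a).1 z hz
    exact ⟨y, hy, z, hxz, hzy⟩
  · obtain ⟨z, hz, hzy⟩ := (hwv a).2 y hy
    obtain ⟨x, hx, hxz⟩ := (huw a).2 z hz
    exact ⟨x, hx, z, hxz, hzy⟩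

theorem isCompatible_inv : IsCompatible (relLift (PowExp A) ξ) SetRel.inv := by
  rintro R ⟨u, v⟩ h
  replace h := (mem_relLift_iff ξ).1 (SetRel.mem_inv.1 h)
  exact (mem_relLift_iff ξ).2 fun a => ⟨(h a).2, (h a).1⟩

theorem isCompatible_id : IsCompatible (relLift (PowExp A) ξ) fun _ => SetRel.id := by
  rintro R ⟨u, v⟩ h
  obtain rfl : u = v := h
  exact (mem_relLift_iff ξ).2 fun a => ⟨fun x hx => ⟨x, hx, rfl⟩, fun x hx => ⟨x, hx, rfl⟩⟩

end RelLift

/-! ### From contextual to congruence closure -/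

section Congruence

variable {T : Type u → Type v} [Functor T] {Z : Type u} {α : T Z → Z}

theorem cgrStep_mono (hα : IsUpToTechnique (ctx T α)) : IsUpToTechnique (cgrStep T α) :=
  fun _ _ h => Set.union_subset_union (Set.union_subset_union (Set.union_subset_union
    (SetRel.comp_subset_comp h h) (Set.preimage_mono h)) (hα h)) le_rfl

theorem cgr_mono (hα : IsUpToTechnique (ctx T α)) : IsUpToTechnique (cgr T α) :=
  fun _ _ h => Set.iUnion_mono fun n =>
    Monotone.iterate (f := cgrStep T α) (fun _ _ h => cgrStep_mono hα h) n h

theorem cgr_isCompatible {A : Type*} {ξ : Z → A → Set Z} (hα : IsUpToTechnique (ctx T α))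
    (hc : IsCompatible (relLift (PowExp A) ξ) (ctx T α)) :
    IsCompatible (relLift (PowExp A) ξ) (cgr T α) := by
  have hstep : IsCompatible (relLift (PowExp A) ξ) (cgrStep T α) := by
    intro R
    refine Set.union_subset (Set.union_subset (Set.union_subset ?_ ?_) ?_) ?_
    · exact (isCompatible_comp ξ R).trans
        (relLift_mono ξ fun _ h => Or.inl (Or.inl (Or.inl h)))
    · exact (isCompatible_inv ξ R).trans
        (relLift_mono ξ fun _ h => Or.inl (Or.inl (Or.inr h)))
    · exact (hc R).trans (relLift_mono ξ fun _ h => Or.inl (Or.inr h))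
    · exact (isCompatible_id ξ R).trans (relLift_mono ξ fun _ h => Or.inr h)
  intro R
  refine Set.iUnion_subset fun n => Set.Subset.trans ?_
    (relLift_mono ξ (Set.subset_iUnion (fun n => (cgrStep T α)^[n] R) n))
  induction n with
  | zero => exact le_rfl
  | succ n ih =>
    rw [Function.iterate_succ_apply', Function.iterate_succ_apply']
    exact (cgrStep_mono hα ih).trans (hstep _)

end Congruence

/-! ### Contextual closure as convex hull, and its compatibility -/

section Context

variable {X : Type u} {A : Type v}

theorem mem_ctx_join_iff {R : SetRel (StdSimplex ℝ X) (StdSimplex ℝ X)}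
    {q : StdSimplex ℝ X × StdSimplex ℝ X} :
    q ∈ ctx (fun Y : Type u => StdSimplex ℝ Y) StdSimplex.join R ↔
      ∃ t : StdSimplex ℝ R, q = (t.iConvexComb (proj₁ R), t.iConvexComb (proj₂ R)) :=
  Iff.rfl

theorem iConvexComb_mem_ctx_join {I : Type*} {R : SetRel (StdSimplex ℝ X) (StdSimplex ℝ X)}
    {w : StdSimplex ℝ I} {φ ψ : I → StdSimplex ℝ X}
    (h : ∀ i ∈ w.weights.support, (φ i, ψ i) ∈ R) :
    (w.iConvexComb φ, w.iConvexComb ψ) ∈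
      ctx (fun Y : Type u => StdSimplex ℝ Y) StdSimplex.join R := by
  classical
  obtain ⟨i₀, hi₀⟩ := w.support_weights_nonempty
  -- Indices of weight zero need not give pairs in `R`; they are sent to the pair at `i₀`.
  let g : I → R := fun i =>
    if hi : i ∈ w.weights.support then ⟨(φ i, ψ i), h i hi⟩ else ⟨(φ i₀, ψ i₀), h i₀ hi₀⟩
  have hg {i : I} (hi : w.weights i ≠ 0) : (g i).1 = (φ i, ψ i) :=
    congrArg Subtype.val (dif_pos (Finsupp.mem_support_iff.2 hi))
  refine mem_ctx_join_iff.2 ⟨w.map g, ?_⟩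
  rw [iConvexComb_map, iConvexComb_map]
  exact Prod.ext (iConvexComb_congr fun i hi => (congrArg Prod.fst (hg hi)).symm)
    (iConvexComb_congr fun i hi => (congrArg Prod.snd (hg hi)).symm)

theorem ctx_join_mono :
    IsUpToTechnique (ctx (fun Y : Type u => StdSimplex ℝ Y) (StdSimplex.join (R := ℝ) (M := X))) := by
  rintro R S hRS q hq
  obtain ⟨t, rfl⟩ := mem_ctx_join_iff.1 hq
  exact iConvexComb_mem_ctx_join fun r _ => hRS r.2

theorem ctx_join_eq_convexHullRel (R : SetRel (StdSimplex ℝ X) (StdSimplex ℝ X)) :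
    ctx (fun Y : Type u => StdSimplex ℝ Y) StdSimplex.join R = convexHullRel R := by
  classical
  ext ⟨q₁, q₂⟩
  constructor
  · intro hq
    obtain ⟨t, ht⟩ := mem_ctx_join_iff.1 hq
    obtain ⟨rfl, rfl⟩ := Prod.mk.inj ht
    -- Indexing by the support alone makes every coefficient positive.
    let e := t.weights.support.equivFin
    have hsum {E : Type u} [AddCommMonoid E] (F : R → E) :
        ∑ i, F (e.symm i) = ∑ r ∈ t.weights.support, F r :=
      (e.symm.sum_comp fun r => F r.1).trans (Finset.sum_coe_sort ..)
    have htot : ∑ r ∈ t.weights.support, t.weights r = 1 := t.total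
    refine ⟨_, fun i => t.weights (e.symm i), fun i => proj₁ R (e.symm i),
      fun i => proj₂ R (e.symm i), fun i => ⟨?_, ?_⟩, ?_, fun i => (e.symm i).1.2, ?_, ?_⟩
    · exact lt_of_le_of_ne (t.weights_nonneg _)
        (Ne.symm (Finsupp.mem_support_iff.1 (e.symm i).2))
    · rw [← htot]
      exact Finset.single_le_sum (fun r _ => t.weights_nonneg r) (e.symm i).2
    · rw [e.symm.sum_comp fun r => t.weights r.1, Finset.sum_coe_sort, htot]
    · rw [weights_iConvexComb_eq_sum, hsum fun r => t.weights r • (proj₁ R r).weights]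
      rfl
    · rw [weights_iConvexComb_eq_sum, hsum fun r => t.weights r • (proj₂ R r).weights]
      rfl
  · rintro ⟨n, p, φ, ψ, hp, hsum, hR, h₁, h₂⟩
    let w : StdSimplex ℝ (Fin n) :=
      ⟨Finsupp.equivFunOnFinite.symm p, fun i => (hp i).1.le, by
        rw [Finsupp.sum_fintype _ _ fun _ => rfl]; exact hsum⟩
    have hw (χ : Fin n → StdSimplex ℝ X) :
        (w.iConvexComb χ).weights = ∑ i, p i • (χ i).weights := by
      rw [weights_iConvexComb_eq_sum, Finsupp.sum_fintype _ _ fun i => zero_smul ℝ (χ i).weights]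
      rfl
    obtain rfl : q₁ = w.iConvexComb φ := StdSimplex.ext (h₁.trans (hw φ).symm)
    obtain rfl : q₂ = w.iConvexComb ψ := StdSimplex.ext (h₂.trans (hw ψ).symm)
    exact iConvexComb_mem_ctx_join fun i _ => hR i

theorem ctx_join_isCompatible (c : X → A → Set (StdSimplex ℝ X)) :
    IsCompatible (relLift (PowExp A) (determinize c))
      (ctx (fun Y : Type u => StdSimplex ℝ Y) StdSimplex.join) := by
  classical
  rintro R ⟨u, v⟩ huv
  obtain ⟨t, ht⟩ := mem_ctx_join_iff.1 huv
  obtain ⟨rfl, rfl⟩ := Prod.mk.inj ht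
  have hr (r : relLift (PowExp A) (determinize c) R) := (mem_relLift_iff (determinize c)).1 r.2
  refine (mem_relLift_iff _).2 fun a => ⟨fun x hx => ?_, fun y hy => ?_⟩
  · obtain ⟨θ, hθ, rfl⟩ := exists_of_mem_determinize_iConvexComb c hx
    -- `θ r` is a genuine move only when `r` has positive weight; elsewhere any value will do.
    have hex (r) : ∃ y, r ∈ t.weights.support →
        y ∈ determinize c (proj₂ _ r) a ∧ (θ r, y) ∈ R := by
      by_cases h : r ∈ t.weights.support
      · obtain ⟨y, hy⟩ := (hr r a).1 _ (hθ r h)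
        exact ⟨y, fun _ => hy⟩
      · exact ⟨θ r, fun h' => (h h').elim⟩
    choose η hη using hex
    exact ⟨_, iConvexComb_mem_determinize c fun r h => (hη r h).1,
      iConvexComb_mem_ctx_join fun r h => (hη r h).2⟩
  · obtain ⟨θ, hθ, rfl⟩ := exists_of_mem_determinize_iConvexComb c hy
    have hex (r) : ∃ x, r ∈ t.weights.support →
        x ∈ determinize c (proj₁ _ r) a ∧ (x, θ r) ∈ R := by
      by_cases h : r ∈ t.weights.support
      · obtain ⟨x, hx⟩ := (hr r a).2 _ (hθ r h)
        exact ⟨x, fun _ => hx⟩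
      · exact ⟨θ r, fun h' => (h h').elim⟩
    choose η hη using hex
    exact ⟨_, iConvexComb_mem_determinize c fun r h => (hη r h).1,
      iConvexComb_mem_ctx_join fun r h => (hη r h).2⟩

end Context

end ProbAut

theorem mainTheorem8 {X : Type u} {A : Type v}
    (c : X → A → Set (StdSimplex ℝ X)) :
    (∀ R : SetRel (StdSimplex ℝ X) (StdSimplex ℝ X),
      ProbAut.ctx (fun Y : Type u => StdSimplex ℝ Y) StdSimplex.join R =
        ProbAut.convexHullRel R) ∧
    ProbAut.IsUpToTechnique (ProbAut.convexHullRel (X := X)) ∧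
    ProbAut.IsCompatible
      (ProbAut.relLift (ProbAut.PowExp A) (ProbAut.determinize c))
      ProbAut.convexHullRel ∧
    ProbAut.IsUpToTechnique
      (ProbAut.cgr (fun Y : Type u => StdSimplex ℝ Y) (StdSimplex.join (R := ℝ) (M := X))) ∧
    ProbAut.IsCompatible
      (ProbAut.relLift (ProbAut.PowExp A) (ProbAut.determinize c))
      (ProbAut.cgr (fun Y : Type u => StdSimplex ℝ Y) StdSimplex.join) :=
  have h := funext (ProbAut.ctx_join_eq_convexHullRel (X := X))
  ⟨ProbAut.ctx_join_eq_convexHullRel, h ▸ ProbAut.ctx_join_mono,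
    h ▸ ProbAut.ctx_join_isCompatible c, ProbAut.cgr_mono ProbAut.ctx_join_mono,
    ProbAut.cgr_isCompatible ProbAut.ctx_join_mono (ProbAut.ctx_join_isCompatible c)⟩
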